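/- Let $G$ be a finite tree and let $w$ assign a positive real weight to every vertex of $G$. An edge partition tree (EPT) of $G$ is defined inductively: if $G$ has a single vertex, it is the rooted tree with a single node, that vertex; otherwise its root is an edge $e$ of $G$ and its two subtrees are EPTs of the two components of $G\setminus e$. The leaves of an EPT $T$ are thus the vertices of $G$; put $\mathsf{EPT\text{-}sum}(G,T)=\sum_{v\in V(G)} w_v\cdot \mathrm{depth}_T(v)$, where the root has depth $0$, and let $\mathsf{EPT\text{-}sum}(G)=\min_T \mathsf{EPT\text{-}sum}(G,T)$ over all EPTs $T$ of $G$. The balanced cut algorithm builds an EPT of $G$ as follows: on a single vertex it returns that vertex; otherwise it chooses as the root an edge $e$ that minimizes the maximum of the total vertex weights of the two components of $G\setminus e$ (ties are broken arbitrarily), and it recurses on the two components. (i) For every finite tree $G$ with positive vertex weights, the minimum defining $\mathsf{EPT\text{-}sum}(G)$ is attained, the balanced cut algorithm has at least one possible output, and every possible output $T$ is an EPT of $G$ with $$\mathsf{EPT\text{-}sum}(G,T)\le \tfrac32\,\mathsf{EPT\text{-}sum}(G).$$ (ii) The constant $\tfrac32$ is best possible: for every real $c<\tfrac32$ and every natural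 number $N$ there is a tree $G$ with at least $N$ vertices and with positive vertex weights such that every possible output $T$ of the balanced cut algorithm on $G$ satisfies $\mathsf{EPT\text{-}sum}(G,T)> c\cdot\mathsf{EPT\text{-}sum}(G)$. -/

import Mathlib

open Set

/-- Rooted full binary trees whose leaves are labelled by vertices and whose internal nodes are
labelled by edges of a graph with vertex type `V`. -/
inductive EPTree (V : Type*) where
  | leaf (v : V) : EPTree V
  | node (e : Sym2 V) (l r : EPTree V) : EPTree V

namespace EPTree

variable {V : Type*}

/-- The sum of `w v * depth` over all leaves `v` of the tree, when the root has depth `d`. -/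
def weightedDepthSum (w : V → ℝ) : ℕ → EPTree V → ℝ
  | d, leaf v => w v * d
  | d, node _ l r => weightedDepthSum w (d + 1) l + weightedDepthSum w (d + 1) r

/-- The EPT-sum with respect to `T`: the sum over all leaves `v` of `w v` times the depth of `v`
in `T`, the root having depth `0`. -/
def eptSum (w : V → ℝ) (T : EPTree V) : ℝ := weightedDepthSum w 0 T

end EPTree

namespace SimpleGraph

variable {V : Type*}

/-- The vertex set of the component containing `u` of the graph obtained from the induced
subgraph `G[S]` by deleting the edge `uv`. -/
def cutSide (G : SimpleGraph V) (S : Set V) (u v : V) : Set V :=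
  {x | ((G.induce S).spanningCoe.deleteEdges {s(u, v)}).Reachable u x}

/-- `G.IsEPT S T`: `T` is an edge partition tree of the subtree `G[S]` of the tree `G`.
Every edge of a tree is a bridge, so cutting an edge `uv` of `G[S]` leaves exactly two components,
each of them the subgraph of `G` induced by its vertex set. -/
inductive IsEPT (G : SimpleGraph V) : Set V → EPTree V → Prop
  | leaf (v : V) : IsEPT G {v} (EPTree.leaf v)
  | node {S : Set V} {u v : V} {l r : EPTree V} (hu : u ∈ S) (hv : v ∈ S) (huv : G.Adj u v)
      (hl : IsEPT G (G.cutSide S u v) l) (hr : IsEPT G (G.cutSide S v u) r) :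
      IsEPT G S (EPTree.node s(u, v) l r)

/-- The set of all values of the EPT-sum over the edge partition trees of `G`. -/
def eptSumValues (G : SimpleGraph V) (w : V → ℝ) : Set ℝ :=
  {c | ∃ T : EPTree V, G.IsEPT univ T ∧ T.eptSum w = c}

/-- The EPT-sum of the vertex-weighted tree `G`: the minimum of the EPT-sum over all edge partition
trees of `G`. -/
noncomputable def eptSum (G : SimpleGraph V) (w : V → ℝ) : ℝ := sInf (G.eptSumValues w)

variable [Fintype V]

/-- The total weight of a set of vertices. -/
noncomputable def setWeight (w : V → ℝ) (S : Set V) : ℝ := ∑ v, S.indicator w v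

/-- The weight of the heaviest component of `G[S]` minus the edge `uv`. -/
noncomputable def cutWeight (G : SimpleGraph V) (w : V → ℝ) (S : Set V) (u v : V) : ℝ :=
  max (setWeight w (G.cutSide S u v)) (setWeight w (G.cutSide S v u))

/-- `uv` is a balanced edge of `G[S]`: among all edges of `G[S]`, deleting it minimizes the weight
of the heaviest component. -/
def IsBalancedEdge (G : SimpleGraph V) (w : V → ℝ) (S : Set V) (u v : V) : Prop :=
  u ∈ S ∧ v ∈ S ∧ G.Adj u v ∧
    ∀ x ∈ S, ∀ y ∈ S, G.Adj x y → G.cutWeight w S u v ≤ G.cutWeight w S x y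

/-- `G.IsBalancedCutOutput w S T`: `T` is a possible output of the balanced cut algorithm on the
subtree `G[S]` with vertex weights `w`. The algorithm returns a leaf on a single vertex; otherwise
it puts some balanced edge (ties are broken arbitrarily) at the root and recurses on the two
components. -/
inductive IsBalancedCutOutput (G : SimpleGraph V) (w : V → ℝ) : Set V → EPTree V → Prop
  | leaf (v : V) : IsBalancedCutOutput G w {v} (EPTree.leaf v)
  | node {S : Set V} {u v : V} {l r : EPTree V} (huv : G.IsBalancedEdge w S u v)
      (hl : IsBalancedCutOutput G w (G.cutSide S u v) l)
      (hr : IsBalancedCutOutput G w (G.cutSide S v u) r) :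
      IsBalancedCutOutput G w S (EPTree.node s(u, v) l r)

end SimpleGraph

/-! ### Half-trees: the two sides of an edge -/

namespace SimpleGraph

variable {V : Type*} {G : SimpleGraph V} {S : Set V} {u v x y : V}

/-! Write W(S) for the weight and OPT(S) for the least cost of a connected S. A root edge
contributes W(S), and the two sides contribute their own costs. The upper bound compares the
balanced edge with an optimal root, using two facts. Savings: if an edge splits S into A and B, then
OPT(A) + OPT(B) is below OPT(S) by at least min(W(A), W(B)) (`optSum_sides_add_min_le`), and by W(A)
if no piece cut off inside A outweighs B (`optSum_sides_add_setWeight_le`). Exchange: the sides of a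
balanced edge have total optimum at most W(B) above that of the sides of any edge with lighter side
B (`IsBalancedEdge.optSum_sides_le_of_edge`).

Bounding the algorithm on a side A by 3/2 OPT(A) and then splitting A at the optimal root charges
3/2 W(A), which can be too much. The induction therefore carries a second bound, in `ApproxBound`,
which charges W(A) once and only the lighter piece at rate 3/2; it follows from exchange. The case
analysis is `IsBalancedEdge.add_le_of_root`.

For sharpness, take a spider with legs of length two and geometrically decreasing weights
concentrated on the tips. Balanced cuts detach the heaviest leg and must then cut it again, at cost
about 3·2^(n+1). Cutting off the tips directly, heaviest first, costs 2·2^(n+1) + O(n²). -/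

/-- The component containing `u` of the graph obtained from `G` by deleting the edge `uv`. -/
def halfTree (G : SimpleGraph V) (u v : V) : Set V :=
  {x | (G.deleteEdges {s(u, v)}).Reachable u x}

/-- `S` is nonempty and induces a connected subgraph of `G`. -/
def ConnectedOn (G : SimpleGraph V) (S : Set V) : Prop :=
  S.Nonempty ∧ ∀ x ∈ S, ∀ y ∈ S, (G.induce S).spanningCoe.Reachable x y

theorem Reachable.mem_of_adj_closed {K : SimpleGraph V} {P : Set V}
    (hP : ∀ a b, K.Adj a b → a ∈ P → b ∈ P) (h : K.Reachable x y) (hx : x ∈ P) : y ∈ P := by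
  obtain ⟨p⟩ := h
  induction p with
  | nil => exact hx
  | cons hadj _ ih => exact ih (hP _ _ hadj hx)

theorem spanningCoe_induce_adj_iff :
    (G.induce S).spanningCoe.Adj x y ↔ x ∈ S ∧ y ∈ S ∧ G.Adj x y := by
  simp [SimpleGraph.map_adj]
  tauto

theorem deleteEdge_adj_iff : (G.deleteEdges {s(u, v)}).Adj x y ↔ G.Adj x y ∧ s(x, y) ≠ s(u, v) := by
  simp [deleteEdges_adj]

theorem cutSide_adj_iff : ((G.induce S).spanningCoe.deleteEdges {s(u, v)}).Adj x y ↔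
    (x ∈ S ∧ y ∈ S ∧ G.Adj x y) ∧ s(x, y) ≠ s(u, v) := by
  rw [deleteEdge_adj_iff, spanningCoe_induce_adj_iff]

theorem left_mem_halfTree (G : SimpleGraph V) (u v : V) : u ∈ G.halfTree u v := Reachable.refl _

theorem halfTree_adj_closed (hxy : G.Adj x y) (hne : s(x, y) ≠ s(u, v)) :
    x ∈ G.halfTree u v ↔ y ∈ G.halfTree u v := by
  have h : (G.deleteEdges {s(u, v)}).Adj x y := deleteEdge_adj_iff.2 ⟨hxy, hne⟩
  exact ⟨fun hx => Reachable.trans hx h.reachable, fun hy => Reachable.trans hy h.symm.reachable⟩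

theorem halfTree_subset_of_closed {A : Set V} (hu : u ∈ A)
    (hA : ∀ a b, G.Adj a b → a ∈ A → b ∉ A → s(a, b) = s(u, v)) : G.halfTree u v ⊆ A := by
  intro z hz
  refine Reachable.mem_of_adj_closed (fun a b hab ha => ?_) hz hu
  rw [deleteEdge_adj_iff] at hab
  by_contra hb
  exact hab.2 (hA a b hab.1 ha hb)

theorem IsTree.right_notMem_halfTree (hG : G.IsTree) (huv : G.Adj u v) :
    v ∉ G.halfTree u v := by
  have h := isAcyclic_iff_forall_adj_isBridge.1 hG.isAcyclic huv
  rw [isBridge_iff] at h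
  exact h

theorem IsTree.mem_halfTree_iff (hG : G.IsTree) (huv : G.Adj u v) :
    x ∈ G.halfTree u v ↔ x ∉ G.halfTree v u := by
  constructor
  · intro h1 h2
    refine hG.right_notMem_halfTree huv (Reachable.trans h1 (Reachable.symm ?_))
    rw [Sym2.eq_swap]
    exact h2
  · intro h1
    have key : x ∈ G.halfTree u v ∪ G.halfTree v u := by
      refine Reachable.mem_of_adj_closed (K := G) (fun a b hab ha => ?_)
        (hG.connected.preconnected u x) (Or.inl (left_mem_halfTree G u v))
      by_cases hne : s(a, b) = s(u, v)
      · rcases Sym2.eq_iff.1 hne with ⟨rfl, rfl⟩ | ⟨rfl, rfl⟩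
        · exact Or.inr (left_mem_halfTree G _ _)
        · exact Or.inl (left_mem_halfTree G _ _)
      · rcases ha with ha | ha
        · exact Or.inl ((halfTree_adj_closed hab hne).1 ha)
        · exact Or.inr ((halfTree_adj_closed hab (by rwa [Sym2.eq_swap (a := v)])).1 ha)
    exact key.resolve_right h1

/-- A set left only through `uv` contains the half-tree of `u`, and its complement contains that of
`v`; the half-trees being complementary, equality follows. This identifies the half-trees of the
spider. -/
theorem IsTree.halfTree_eq_of_closed (hG : G.IsTree) (huv : G.Adj u v) {A : Set V} (hu : u ∈ A)
    (hv : v ∉ A) (hA : ∀ a b, G.Adj a b → a ∈ A → b ∉ A → s(a, b) = s(u, v)) :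
    G.halfTree u v = A := by
  refine subset_antisymm (halfTree_subset_of_closed hu hA) fun z hz => ?_
  rw [hG.mem_halfTree_iff huv]
  intro hz'
  refine halfTree_subset_of_closed (A := Aᶜ) hv (fun a b hab ha hb => ?_) hz' hz
  rw [Sym2.eq_swap, hA b a hab.symm (not_not.1 hb) ha, Sym2.eq_swap]

/-- `xy` is an edge on the `u`-side of the edge `uv`, with `x` closer to `uv` than `y`. -/
structure EdgeBeyond (G : SimpleGraph V) (u v x y : V) : Prop where
  adj : G.Adj u v
  adj' : G.Adj x y
  left : x ∈ G.halfTree u v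
  right : y ∈ G.halfTree u v
  left' : u ∈ G.halfTree x y
  right' : v ∈ G.halfTree x y

theorem EdgeBeyond.symm (h : G.EdgeBeyond u v x y) : G.EdgeBeyond x y u v :=
  ⟨h.adj', h.adj, h.left', h.right', h.left, h.right⟩

theorem EdgeBeyond.subset (hG : G.IsTree) (h : G.EdgeBeyond u v x y) :
    G.halfTree y x ⊆ G.halfTree u v := by
  intro z hz
  rw [hG.mem_halfTree_iff h.adj]
  intro hz'
  have hsub : G.halfTree v u ⊆ G.halfTree x y ∩ G.halfTree v u := by
    refine halfTree_subset_of_closed ⟨h.right', left_mem_halfTree G v u⟩ fun a b hab ha hb => ?_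
    by_contra hne
    have hb' := (halfTree_adj_closed hab hne).1 ha.2
    refine hb ⟨(halfTree_adj_closed hab ?_).1 ha.1, hb'⟩
    intro heq
    have hx := (hG.mem_halfTree_iff h.adj).1 h.left
    have hy := (hG.mem_halfTree_iff h.adj).1 h.right
    rcases Sym2.eq_iff.1 heq with ⟨rfl, rfl⟩ | ⟨rfl, rfl⟩
    · exact hx ha.2
    · exact hy ha.2
  exact (hG.mem_halfTree_iff h.adj').1 (hsub hz').1 hz

/-- Neither of two distinct edges separates the endpoints of the other, so each lies wholly on one
side of the other; the four combinations are the four cases. -/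
theorem IsTree.edgeBeyond_cases (hG : G.IsTree) (huv : G.Adj u v) (hxy : G.Adj x y) :
    s(x, y) = s(u, v) ∨ G.EdgeBeyond u v x y ∨ G.EdgeBeyond u v y x ∨
      G.EdgeBeyond v u x y ∨ G.EdgeBeyond v u y x := by
  by_cases hne : s(x, y) = s(u, v)
  · exact Or.inl hne
  have h1 := halfTree_adj_closed hxy hne
  have h2 : x ∈ G.halfTree v u ↔ y ∈ G.halfTree v u :=
    halfTree_adj_closed hxy (by rwa [Sym2.eq_swap (a := v)])
  have h3 := halfTree_adj_closed huv (Ne.symm hne)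
  have h4 : u ∈ G.halfTree y x ↔ v ∈ G.halfTree y x :=
    halfTree_adj_closed huv (by rw [Sym2.eq_swap (a := y)]; exact Ne.symm hne)
  have h5 := hG.mem_halfTree_iff (x := x) huv
  have h6 := hG.mem_halfTree_iff (x := u) hxy
  refine Or.inr ?_
  by_cases a : x ∈ G.halfTree u v <;> by_cases b : u ∈ G.halfTree x y
  · exact Or.inl ⟨huv, hxy, a, h1.1 a, b, h3.1 b⟩
  · have b' : u ∈ G.halfTree y x := by tauto
    exact Or.inr (Or.inl ⟨huv, hxy.symm, h1.1 a, a, b', h4.1 b'⟩)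
  · have a' : x ∈ G.halfTree v u := by tauto
    exact Or.inr (Or.inr (Or.inl ⟨huv.symm, hxy, a', h2.1 a', h3.1 b, b⟩))
  · have a' : x ∈ G.halfTree v u := by tauto
    have b' : u ∈ G.halfTree y x := by tauto
    exact Or.inr (Or.inr (Or.inr ⟨huv.symm, hxy.symm, h2.1 a', a', h4.1 b', b'⟩))

/-- This expresses every piece met in a recursion as an intersection with half-trees of the whole
tree, so nested cuts become set algebra. -/
theorem IsTree.cutSide_eq (hG : G.IsTree) (hS : G.ConnectedOn S) (hu : u ∈ S) (hv : v ∈ S)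
    (huv : G.Adj u v) : G.cutSide S u v = S ∩ G.halfTree u v := by
  have hmono : ∀ {u v : V}, u ∈ S → G.cutSide S u v ⊆ S ∩ G.halfTree u v := by
    intro u v hu z hz
    refine ⟨Reachable.mem_of_adj_closed (fun a b hab _ => ?_) hz hu, ?_⟩
    · exact (cutSide_adj_iff.1 hab).1.2.1
    · refine Reachable.mono (fun a b hab => ?_) hz
      have := cutSide_adj_iff.1 hab
      exact deleteEdge_adj_iff.2 ⟨this.1.2.2, this.2⟩
  refine subset_antisymm (hmono hu) fun z hz => ?_
  have key : z ∈ G.cutSide S u v ∪ G.cutSide S v u := by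
    refine Reachable.mem_of_adj_closed (K := (G.induce S).spanningCoe) (fun a b hab ha => ?_)
      (hS.2 u hu z hz.1) (Or.inl (Reachable.refl _))
    by_cases hne : s(a, b) = s(u, v)
    · rcases Sym2.eq_iff.1 hne with ⟨rfl, rfl⟩ | ⟨rfl, rfl⟩
      · exact Or.inr (Reachable.refl _)
      · exact Or.inl (Reachable.refl _)
    · rcases ha with ha | ha
      · exact Or.inl (Reachable.trans ha (deleteEdge_adj_iff.2 ⟨hab, hne⟩ : _).reachable)
      · rw [Sym2.eq_swap (a := u)] at hne
        exact Or.inr (Reachable.trans ha (deleteEdge_adj_iff.2 ⟨hab, hne⟩ : _).reachable)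
  exact key.resolve_right fun h => (hG.mem_halfTree_iff huv).1 hz.2 (hmono hv h).2

theorem ConnectedOn.inter_halfTree (hS : G.ConnectedOn S) (hG : G.IsTree) (hu : u ∈ S) (hv : v ∈ S)
    (huv : G.Adj u v) : G.ConnectedOn (S ∩ G.halfTree u v) := by
  refine ⟨⟨u, hu, left_mem_halfTree G u v⟩, ?_⟩
  have key : ∀ x ∈ S ∩ G.halfTree u v, (G.induce (S ∩ G.halfTree u v)).spanningCoe.Reachable u x := by
    intro x hx
    have hx' := hx
    rw [← hG.cutSide_eq hS hu hv huv] at hx'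
    have hcl : x ∈ {x | x ∈ S ∩ G.halfTree u v ∧
        (G.induce (S ∩ G.halfTree u v)).spanningCoe.Reachable u x} := by
      refine Reachable.mem_of_adj_closed (fun a b hab ha => ?_) hx'
        ⟨⟨hu, left_mem_halfTree G u v⟩, Reachable.refl _⟩
      have h := cutSide_adj_iff.1 hab
      have hb : b ∈ S ∩ G.halfTree u v := ⟨h.1.2.1, (halfTree_adj_closed h.1.2.2 h.2).1 ha.1.2⟩
      exact ⟨hb, ha.2.trans (spanningCoe_induce_adj_iff.2 ⟨ha.1, hb, h.1.2.2⟩ : _).reachable⟩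
    exact hcl.2
  exact fun x hx y hy => (key x hx).symm.trans (key y hy)

theorem IsTree.connectedOn_univ (hG : G.IsTree) : G.ConnectedOn univ := by
  refine ⟨hG.connected.nonempty.elim fun x => ⟨x, trivial⟩, fun x _ y _ => ?_⟩
  refine Reachable.mono (fun a b hab => ?_) (hG.connected.preconnected x y)
  exact spanningCoe_induce_adj_iff.2 ⟨trivial, trivial, hab⟩

theorem connectedOn_singleton (G : SimpleGraph V) (v : V) : G.ConnectedOn {v} := by
  refine ⟨⟨v, rfl⟩, ?_⟩
  rintro x rfl y rfl
  exact Reachable.refl _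

theorem ConnectedOn.eq_singleton_or_exists_adj (hS : G.ConnectedOn S) :
    (∃ v, S = {v}) ∨ ∃ u ∈ S, ∃ v ∈ S, G.Adj u v := by
  by_cases h : ∃ u ∈ S, ∃ v ∈ S, G.Adj u v
  · exact Or.inr h
  · obtain ⟨a, ha⟩ := hS.1
    refine Or.inl ⟨a, subset_antisymm (fun b hb => ?_) (by simpa using ha)⟩
    refine Reachable.mem_of_adj_closed (fun c d hcd _ => ?_) (hS.2 a ha b hb) rfl
    have := spanningCoe_induce_adj_iff.1 hcd
    exact absurd ⟨c, this.1, d, this.2.1, this.2.2⟩ h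

theorem IsTree.inter_halfTree_ssubset (hG : G.IsTree) (hv : v ∈ S) (huv : G.Adj u v) :
    S ∩ G.halfTree u v ⊂ S :=
  ⟨inter_subset_left, fun h => hG.right_notMem_halfTree huv (h hv).2⟩

end SimpleGraph

/-! ### Weights of pieces and the cost recursion -/

namespace SimpleGraph

variable {V : Type*} {G : SimpleGraph V} {w : V → ℝ} {S A B : Set V} {u v x y : V}

/-! Identities between the pieces cut out of `S` by two edges. -/

theorem EdgeBeyond.inter_far (hG : G.IsTree) (h : G.EdgeBeyond u v x y) (S : Set V) :
    S ∩ G.halfTree u v ∩ G.halfTree y x = S ∩ G.halfTree y x := by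
  ext z
  have : z ∈ G.halfTree y x → z ∈ G.halfTree u v := fun hz => h.subset hG hz
  simp only [mem_inter_iff]
  tauto

theorem EdgeBeyond.inter_near (hG : G.IsTree) (h : G.EdgeBeyond u v x y) (S : Set V) :
    S ∩ G.halfTree x y ∩ G.halfTree v u = S ∩ G.halfTree v u := h.symm.inter_far hG S

theorem EdgeBeyond.inter_mid (S : Set V) :
    S ∩ G.halfTree x y ∩ G.halfTree u v = S ∩ G.halfTree u v ∩ G.halfTree x y := by
  rw [inter_assoc, inter_comm (G.halfTree x y), ← inter_assoc]

theorem IsTree.disjoint_inter_halfTree (hG : G.IsTree) (huv : G.Adj u v) (S : Set V) :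
    Disjoint (S ∩ G.halfTree u v) (S ∩ G.halfTree v u) :=
  Set.disjoint_left.2 fun _ h1 h2 => (hG.mem_halfTree_iff huv).1 h1.2 h2.2

theorem IsTree.inter_halfTree_union (hG : G.IsTree) (huv : G.Adj u v) (S : Set V) :
    S ∩ G.halfTree u v ∪ S ∩ G.halfTree v u = S := by
  ext z
  have := hG.mem_halfTree_iff (x := z) huv
  simp only [mem_union, mem_inter_iff]
  tauto

theorem IsEPT.node' (hG : G.IsTree) (hS : G.ConnectedOn S) {l r : EPTree V} (hu : u ∈ S)
    (hv : v ∈ S) (huv : G.Adj u v) (hl : G.IsEPT (S ∩ G.halfTree u v) l)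
    (hr : G.IsEPT (S ∩ G.halfTree v u) r) : G.IsEPT S (EPTree.node s(u, v) l r) := by
  rw [← hG.cutSide_eq hS hu hv huv] at hl
  rw [← hG.cutSide_eq hS hv hu huv.symm] at hr
  exact .node hu hv huv hl hr

/-- An edge partition tree of `S` is a leaf or is given by an edge of `S` and edge partition trees
of its two sides. -/
theorem IsEPT.cases_inter (hG : G.IsTree) (hS : G.ConnectedOn S) {T : EPTree V}
    (hT : G.IsEPT S T) : (∃ v, S = {v} ∧ T = .leaf v) ∨
      ∃ u ∈ S, ∃ v ∈ S, G.Adj u v ∧ ∃ l r, G.IsEPT (S ∩ G.halfTree u v) l ∧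
        G.IsEPT (S ∩ G.halfTree v u) r ∧ T = .node s(u, v) l r := by
  cases hT with
  | leaf v => exact Or.inl ⟨v, rfl, rfl⟩
  | @node _ u v l r hu hv huv hl hr =>
    rw [hG.cutSide_eq hS hu hv huv] at hl
    rw [hG.cutSide_eq hS hv hu huv.symm] at hr
    exact Or.inr ⟨u, hu, v, hv, huv, l, r, hl, hr, rfl⟩

section Weight

variable [Fintype V]

theorem setWeight_singleton (w : V → ℝ) (v : V) : setWeight w {v} = w v := by
  classical
  simp [setWeight, indicator_apply]

theorem setWeight_union (h : Disjoint A B) :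
    setWeight w (A ∪ B) = setWeight w A + setWeight w B := by
  simp [setWeight, indicator_union_of_disjoint h, Finset.sum_add_distrib]

theorem setWeight_nonneg (hw : ∀ v, 0 < w v) (S : Set V) : 0 ≤ setWeight w S :=
  Finset.sum_nonneg fun _ _ => indicator_nonneg (fun _ _ => (hw _).le) _

theorem setWeight_mono (hw : ∀ v, 0 < w v) (h : A ⊆ B) : setWeight w A ≤ setWeight w B :=
  Finset.sum_le_sum fun _ _ => indicator_le_indicator_of_subset h (fun a => (hw a).le) _

theorem setWeight_lt (hw : ∀ v, 0 < w v) (h : A ⊆ B) (hx : x ∈ B) (hx' : x ∉ A) :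
    setWeight w A < setWeight w B := by
  refine Finset.sum_lt_sum
    (fun _ _ => indicator_le_indicator_of_subset h (fun a => (hw a).le) _) ⟨x, Finset.mem_univ _, ?_⟩
  simpa [hx, hx'] using hw x

theorem setWeight_pos (hw : ∀ v, 0 < w v) (hx : x ∈ S) : 0 < setWeight w S := by
  have h := setWeight_lt hw (empty_subset S) hx (notMem_empty x)
  simpa [setWeight] using h

theorem IsTree.setWeight_split (hG : G.IsTree) (huv : G.Adj u v) (w : V → ℝ) (S : Set V) :
    setWeight w S = setWeight w (S ∩ G.halfTree u v) + setWeight w (S ∩ G.halfTree v u) := by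
  rw [← setWeight_union (hG.disjoint_inter_halfTree huv S), hG.inter_halfTree_union huv]

theorem IsTree.ncard_split (hG : G.IsTree) (huv : G.Adj u v) (S : Set V) :
    S.ncard = (S ∩ G.halfTree u v).ncard + (S ∩ G.halfTree v u).ncard := by
  rw [← ncard_union_eq (hG.disjoint_inter_halfTree huv S) (toFinite _) (toFinite _),
    hG.inter_halfTree_union huv]

/-- Lowering the root by `d` adds `d` to every depth, and each vertex of `S` is exactly one leaf. -/
theorem IsEPT.weightedDepthSum_eq (hG : G.IsTree) {T : EPTree V} (hT : G.IsEPT S T)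
    (hS : G.ConnectedOn S) (d : ℕ) :
    T.weightedDepthSum w d = T.eptSum w + d * setWeight w S := by
  induction hT generalizing d with
  | leaf v => simp [EPTree.eptSum, EPTree.weightedDepthSum, setWeight_singleton, mul_comm]
  | @node S u v l r hu hv huv _ _ ihl ihr =>
    rw [hG.cutSide_eq hS hu hv huv] at ihl
    rw [hG.cutSide_eq hS hv hu huv.symm] at ihr
    have hl := ihl (hS.inter_halfTree hG hu hv huv)
    have hr := ihr (hS.inter_halfTree hG hv hu huv.symm)
    simp only [EPTree.eptSum, EPTree.weightedDepthSum] at hl hr ⊢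
    rw [hl (d + 1), hr (d + 1), hl (0 + 1), hr (0 + 1), hG.setWeight_split huv w S]
    push_cast
    ring

theorem IsEPT.eptSum_node (hG : G.IsTree) (hS : G.ConnectedOn S) {l r : EPTree V} (hu : u ∈ S)
    (hv : v ∈ S) (huv : G.Adj u v) (hl : G.IsEPT (S ∩ G.halfTree u v) l)
    (hr : G.IsEPT (S ∩ G.halfTree v u) r) :
    (EPTree.node s(u, v) l r).eptSum w = setWeight w S + l.eptSum w + r.eptSum w := by
  have h1 := hl.weightedDepthSum_eq (w := w) hG (hS.inter_halfTree hG hu hv huv) 1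
  have h2 := hr.weightedDepthSum_eq (w := w) hG (hS.inter_halfTree hG hv hu huv.symm) 1
  rw [EPTree.eptSum, EPTree.weightedDepthSum, h1, h2, hG.setWeight_split huv w S]
  push_cast
  ring

end Weight

/-! ### Optimal trees and their root edges -/

section Optimum

variable [Fintype V]

theorem IsTree.finite_setOf_isEPT (hG : G.IsTree) (hS : G.ConnectedOn S) :
    {T | G.IsEPT S T}.Finite := by
  induction S using WellFoundedLT.induction with
  | ind S ih =>
  have key : {T | G.IsEPT S T} ⊆ (EPTree.leaf '' univ) ∪ ⋃ u : V, ⋃ v : V,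
      {T | (u ∈ S ∧ v ∈ S ∧ G.Adj u v) ∧ T ∈ image2 (EPTree.node s(u, v))
        {T | G.IsEPT (S ∩ G.halfTree u v) T} {T | G.IsEPT (S ∩ G.halfTree v u) T}} := by
    intro T hT
    rcases IsEPT.cases_inter hG hS hT with ⟨v, _, rfl⟩ | ⟨u, hu, v, hv, huv, l, r, hl, hr, rfl⟩
    · exact Or.inl ⟨v, trivial, rfl⟩
    · exact Or.inr (mem_iUnion.2 ⟨u, mem_iUnion.2 ⟨v, ⟨hu, hv, huv⟩, l, hl, r, hr, rfl⟩⟩)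
  refine ((toFinite _).union (finite_iUnion fun u => finite_iUnion fun v => ?_)).subset key
  by_cases h : u ∈ S ∧ v ∈ S ∧ G.Adj u v
  · refine ((ih _ (hG.inter_halfTree_ssubset h.2.1 h.2.2)
      (hS.inter_halfTree hG h.1 h.2.1 h.2.2)).image2 _
      (ih _ (hG.inter_halfTree_ssubset h.1 h.2.2.symm)
      (hS.inter_halfTree hG h.2.1 h.1 h.2.2.symm))).subset fun T hT => hT.2
  · simp [h]

theorem IsTree.exists_isEPT (hG : G.IsTree) (hS : G.ConnectedOn S) : ∃ T, G.IsEPT S T := by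
  induction S using WellFoundedLT.induction with
  | ind S ih =>
  rcases hS.eq_singleton_or_exists_adj with ⟨v, rfl⟩ | ⟨u, hu, v, hv, huv⟩
  · exact ⟨_, .leaf v⟩
  · obtain ⟨l, hl⟩ := ih _ (hG.inter_halfTree_ssubset hv huv) (hS.inter_halfTree hG hu hv huv)
    obtain ⟨r, hr⟩ := ih _ (hG.inter_halfTree_ssubset hu huv.symm)
      (hS.inter_halfTree hG hv hu huv.symm)
    exact ⟨_, .node' hG hS hu hv huv hl hr⟩

/-- The minimum of the EPT-sum over the edge partition trees of the subtree `G[S]`. -/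
noncomputable def optSum (G : SimpleGraph V) (w : V → ℝ) (S : Set V) : ℝ :=
  sInf {c | ∃ T : EPTree V, G.IsEPT S T ∧ T.eptSum w = c}

theorem IsTree.isLeast_optSum (hG : G.IsTree) (w : V → ℝ) (hS : G.ConnectedOn S) :
    IsLeast {c | ∃ T : EPTree V, G.IsEPT S T ∧ T.eptSum w = c} (G.optSum w S) := by
  have hfin : {c | ∃ T : EPTree V, G.IsEPT S T ∧ T.eptSum w = c}.Finite :=
    (hG.finite_setOf_isEPT hS).image (EPTree.eptSum w)
  obtain ⟨T, hT⟩ := hG.exists_isEPT hS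
  exact ⟨Set.Nonempty.csInf_mem ⟨_, T, hT, rfl⟩ hfin, fun c hc => csInf_le hfin.bddBelow hc⟩

theorem optSum_singleton (hG : G.IsTree) (w : V → ℝ) (v : V) : G.optSum w {v} = 0 := by
  obtain ⟨T, hT, h⟩ := (hG.isLeast_optSum w (connectedOn_singleton G v)).1
  rw [← h]
  rcases IsEPT.cases_inter hG (connectedOn_singleton G v) hT with
    ⟨v, _, rfl⟩ | ⟨a, ha, b, hb, hab, _⟩
  · simp [EPTree.eptSum, EPTree.weightedDepthSum]
  · rw [mem_singleton_iff] at ha hb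
    exact absurd (ha.trans hb.symm) hab.ne

theorem optSum_le (hG : G.IsTree) (w : V → ℝ) (hS : G.ConnectedOn S) (hu : u ∈ S) (hv : v ∈ S)
    (huv : G.Adj u v) : G.optSum w S ≤
      setWeight w S + G.optSum w (S ∩ G.halfTree u v) + G.optSum w (S ∩ G.halfTree v u) := by
  obtain ⟨l, hl, hl'⟩ := (hG.isLeast_optSum w (hS.inter_halfTree hG hu hv huv)).1
  obtain ⟨r, hr, hr'⟩ := (hG.isLeast_optSum w (hS.inter_halfTree hG hv hu huv.symm)).1
  rw [← hl', ← hr', ← IsEPT.eptSum_node hG hS hu hv huv hl hr]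
  exact (hG.isLeast_optSum w hS).2 ⟨_, .node' hG hS hu hv huv hl hr, rfl⟩

theorem exists_optSum_eq (hG : G.IsTree) (w : V → ℝ) (hS : G.ConnectedOn S) (hu : u ∈ S)
    (hv : v ∈ S) (huv : G.Adj u v) : ∃ x ∈ S, ∃ y ∈ S, G.Adj x y ∧ G.optSum w S =
      setWeight w S + G.optSum w (S ∩ G.halfTree x y) + G.optSum w (S ∩ G.halfTree y x) := by
  obtain ⟨T, hT, h⟩ := (hG.isLeast_optSum w hS).1
  rcases IsEPT.cases_inter hG hS hT with ⟨a, rfl, _⟩ | ⟨x, hx, y, hy, hxy, l, r, hl, hr, rfl⟩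
  · exact absurd (hu.trans hv.symm) huv.ne
  · refine ⟨x, hx, y, hy, hxy, le_antisymm (optSum_le hG w hS hx hy hxy) ?_⟩
    rw [← h, IsEPT.eptSum_node hG hS hx hy hxy hl hr]
    have h1 := (hG.isLeast_optSum w (hS.inter_halfTree hG hx hy hxy)).2 ⟨l, hl, rfl⟩
    have h2 := (hG.isLeast_optSum w (hS.inter_halfTree hG hy hx hxy.symm)).2 ⟨r, hr, rfl⟩
    linarith

/-- The position of the root edge of an optimal edge partition tree relative to an edge `uv`. -/
theorem exists_optimal_root (hG : G.IsTree) (w : V → ℝ) (hS : G.ConnectedOn S) (hu : u ∈ S)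
    (hv : v ∈ S) (huv : G.Adj u v) :
    G.optSum w S = setWeight w S + G.optSum w (S ∩ G.halfTree u v) +
      G.optSum w (S ∩ G.halfTree v u) ∨
    ∃ x ∈ S, ∃ y ∈ S, (G.EdgeBeyond u v x y ∨ G.EdgeBeyond v u x y) ∧ G.optSum w S =
      setWeight w S + G.optSum w (S ∩ G.halfTree x y) + G.optSum w (S ∩ G.halfTree y x) := by
  obtain ⟨x, hx, y, hy, hxy, h⟩ := exists_optSum_eq hG w hS hu hv huv
  have h' : G.optSum w S =
      setWeight w S + G.optSum w (S ∩ G.halfTree y x) + G.optSum w (S ∩ G.halfTree x y) := by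
    rw [h]; ring
  rcases hG.edgeBeyond_cases huv hxy with he | he | he | he | he
  · rcases Sym2.eq_iff.1 he with ⟨rfl, rfl⟩ | ⟨rfl, rfl⟩
    · exact Or.inl h
    · exact Or.inl h'
  · exact Or.inr ⟨x, hx, y, hy, Or.inl he, h⟩
  · exact Or.inr ⟨y, hy, x, hx, Or.inl he, h'⟩
  · exact Or.inr ⟨x, hx, y, hy, Or.inr he, h⟩
  · exact Or.inr ⟨y, hy, x, hx, Or.inr he, h'⟩

end Optimum

end SimpleGraph

/-! ### Savings and exchange inequalities -/

namespace SimpleGraph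

variable {V : Type*} [Fintype V] {G : SimpleGraph V} {w : V → ℝ} {S A B : Set V} {u v x y s t : V}

theorem EdgeBeyond.optSum_side_le (hG : G.IsTree) (w : V → ℝ) (h : G.EdgeBeyond u v x y)
    (hS : G.ConnectedOn S) (hu : u ∈ S) (hv : v ∈ S) (hx : x ∈ S) (hy : y ∈ S) :
    G.optSum w (S ∩ G.halfTree u v) ≤ setWeight w (S ∩ G.halfTree u v) +
      G.optSum w (S ∩ G.halfTree u v ∩ G.halfTree x y) + G.optSum w (S ∩ G.halfTree y x) := by
  have := optSum_le hG w (hS.inter_halfTree hG hu hv h.adj) ⟨hx, h.left⟩ ⟨hy, h.right⟩ h.adj'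
  rwa [h.inter_far hG] at this

theorem EdgeBeyond.setWeight_side (hG : G.IsTree) (w : V → ℝ) (h : G.EdgeBeyond u v x y)
    (S : Set V) : setWeight w (S ∩ G.halfTree u v) =
      setWeight w (S ∩ G.halfTree u v ∩ G.halfTree x y) + setWeight w (S ∩ G.halfTree y x) := by
  have := hG.setWeight_split h.adj' w (S ∩ G.halfTree u v)
  rwa [h.inter_far hG] at this

/-- Solving the two sides of an edge separately saves at least the weight of the lighter side. -/
theorem optSum_sides_add_min_le (hG : G.IsTree) (hw : ∀ v, 0 < w v) (hS : G.ConnectedOn S)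
    (hu : u ∈ S) (hv : v ∈ S) (huv : G.Adj u v) :
    G.optSum w (S ∩ G.halfTree u v) + G.optSum w (S ∩ G.halfTree v u) +
      min (setWeight w (S ∩ G.halfTree u v)) (setWeight w (S ∩ G.halfTree v u)) ≤
      G.optSum w S := by
  induction S using WellFoundedLT.induction generalizing u v with
  | ind S ih =>
  -- The root `xy` contributes W(S), while using it as root of the `u`-side costs only the weight of
  -- that side; the difference is the weight of the `v`-side.
  have step : ∀ u ∈ S, ∀ v ∈ S, ∀ x ∈ S, ∀ y ∈ S, G.EdgeBeyond u v x y →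
      G.optSum w S = setWeight w S + G.optSum w (S ∩ G.halfTree x y) +
        G.optSum w (S ∩ G.halfTree y x) →
      G.optSum w (S ∩ G.halfTree u v) + G.optSum w (S ∩ G.halfTree v u) +
        min (setWeight w (S ∩ G.halfTree u v)) (setWeight w (S ∩ G.halfTree v u)) ≤
        G.optSum w S := by
    intro u hu v hv x hx y hy h heq
    have h1 := ih _ (hG.inter_halfTree_ssubset hy h.adj') (hS.inter_halfTree hG hx hy h.adj')
      ⟨hu, h.left'⟩ ⟨hv, h.right'⟩ h.adj
    rw [h.inter_near hG, EdgeBeyond.inter_mid] at h1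
    have h2 := h.optSum_side_le hG w hS hu hv hx hy
    have h3 := hG.setWeight_split h.adj w S
    have h4 := min_le_right (setWeight w (S ∩ G.halfTree u v)) (setWeight w (S ∩ G.halfTree v u))
    have h5 := le_min (setWeight_nonneg hw (S ∩ G.halfTree u v ∩ G.halfTree x y))
      (setWeight_nonneg hw (S ∩ G.halfTree v u))
    linarith
  rcases exists_optimal_root hG w hS hu hv huv with h | ⟨x, hx, y, hy, h | h, heq⟩
  · have h3 := hG.setWeight_split huv w S
    have h4 := min_le_right (setWeight w (S ∩ G.halfTree u v)) (setWeight w (S ∩ G.halfTree v u))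
    have h5 := setWeight_nonneg hw (S ∩ G.halfTree u v)
    linarith
  · exact step u hu v hv x hx y hy h heq
  · have := step v hv u hu x hx y hy h heq
    rw [min_comm] at this
    linarith

theorem optSum_sides_le (hG : G.IsTree) (hw : ∀ v, 0 < w v) (hS : G.ConnectedOn S)
    (hu : u ∈ S) (hv : v ∈ S) (huv : G.Adj u v) :
    G.optSum w (S ∩ G.halfTree u v) + G.optSum w (S ∩ G.halfTree v u) ≤ G.optSum w S := by
  have h1 := optSum_sides_add_min_le hG hw hS hu hv huv
  have h2 := le_min (setWeight_nonneg hw (S ∩ G.halfTree u v))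
    (setWeight_nonneg hw (S ∩ G.halfTree v u))
  linarith

/-- If no piece that can be cut off on the `u`-side of `uv` is heavier than the `v`-side, then
solving the two sides separately saves at least the weight of the `u`-side. -/
theorem optSum_sides_add_setWeight_le (hG : G.IsTree) (hw : ∀ v, 0 < w v) (hS : G.ConnectedOn S)
    (hu : u ∈ S) (hv : v ∈ S) (huv : G.Adj u v)
    (hle : ∀ x ∈ S, ∀ y ∈ S, G.EdgeBeyond u v x y →
      setWeight w (S ∩ G.halfTree y x) ≤ setWeight w (S ∩ G.halfTree v u)) :
    G.optSum w (S ∩ G.halfTree u v) + G.optSum w (S ∩ G.halfTree v u) +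
      setWeight w (S ∩ G.halfTree u v) ≤ G.optSum w S := by
  induction S using WellFoundedLT.induction with
  | ind S ih =>
  have h3 := hG.setWeight_split huv w S
  rcases exists_optimal_root hG w hS hu hv huv with h | ⟨x, hx, y, hy, h | h, heq⟩
  · have h5 := setWeight_nonneg hw (S ∩ G.halfTree v u)
    linarith
  -- The gain is the `v`-side weight, which is at least that of the piece beyond `y`, plus by
  -- induction the weight of the rest of the `u`-side.
  · have h1 := ih _ (hG.inter_halfTree_ssubset hy h.adj') (hS.inter_halfTree hG hx hy h.adj')
      ⟨hu, h.left'⟩ ⟨hv, h.right'⟩ fun a ha b hb hab => by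
        rw [h.inter_near hG]
        exact (setWeight_mono hw (inter_subset_inter_left _ inter_subset_left)).trans
          (hle a ha.1 b hb.1 hab)
    rw [h.inter_near hG, EdgeBeyond.inter_mid] at h1
    have h2 := h.optSum_side_le hG w hS hu hv hx hy
    have h4 := h.setWeight_side hG w S
    have h5 := hle x hx y hy h
    linarith
  · have h1 := optSum_sides_le hG hw (hS.inter_halfTree hG hx hy h.adj') ⟨hu, h.right'⟩
      ⟨hv, h.left'⟩ huv
    rw [h.inter_near hG, EdgeBeyond.inter_mid] at h1
    have h2 := h.optSum_side_le hG w hS hv hu hx hy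
    linarith

theorem IsBalancedEdge.max_le (hG : G.IsTree) (hS : G.ConnectedOn S)
    (h : G.IsBalancedEdge w S u v) (hx : x ∈ S) (hy : y ∈ S) (hxy : G.Adj x y) :
    max (setWeight w (S ∩ G.halfTree u v)) (setWeight w (S ∩ G.halfTree v u)) ≤
      max (setWeight w (S ∩ G.halfTree x y)) (setWeight w (S ∩ G.halfTree y x)) := by
  obtain ⟨hu, hv, huv, hle⟩ := h
  have := hle x hx y hy hxy
  rwa [cutWeight, cutWeight, hG.cutSide_eq hS hu hv huv, hG.cutSide_eq hS hv hu huv.symm,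
    hG.cutSide_eq hS hx hy hxy, hG.cutSide_eq hS hy hx hxy.symm] at this

theorem IsBalancedEdge.swap (h : G.IsBalancedEdge w S u v) : G.IsBalancedEdge w S v u := by
  obtain ⟨hu, hv, huv, hle⟩ := h
  refine ⟨hv, hu, huv.symm, fun x hx y hy hxy => ?_⟩
  rw [cutWeight, max_comm]
  exact hle x hx y hy hxy

/-- The piece beyond `y` is strictly lighter than the heavier side of `uv`, so balance forces the
other side of `xy` to be at least that heavy; take complements. -/
theorem IsBalancedEdge.setWeight_piece_le (hG : G.IsTree) (hw : ∀ v, 0 < w v)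
    (hS : G.ConnectedOn S) (h : G.IsBalancedEdge w S u v)
    (hle : setWeight w (S ∩ G.halfTree v u) ≤ setWeight w (S ∩ G.halfTree u v))
    (hx : x ∈ S) (hy : y ∈ S) (he : G.EdgeBeyond u v x y) :
    setWeight w (S ∩ G.halfTree y x) ≤ setWeight w (S ∩ G.halfTree v u) := by
  have h1 := h.max_le hG hS hx hy he.adj'
  have h2 : setWeight w (S ∩ G.halfTree y x) < setWeight w (S ∩ G.halfTree u v) :=
    setWeight_lt hw (inter_subset_inter_right _ (he.subset hG)) ⟨hx, he.left⟩
      fun hx' => hG.right_notMem_halfTree he.adj'.symm hx'.2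
  have h3 := hG.setWeight_split he.adj w S
  have h4 := hG.setWeight_split he.adj' w S
  rw [max_eq_left hle] at h1
  rcases le_max_iff.1 h1 with h5 | h5 <;> linarith

/-- Cutting a balanced edge `st` instead of an edge `uv` loses at most the weight of the
`v`-side of `uv`, if that is the lighter side. -/
theorem IsBalancedEdge.optSum_sides_le_of_edge (hG : G.IsTree) (hw : ∀ v, 0 < w v)
    (hS : G.ConnectedOn S) (h : G.IsBalancedEdge w S s t) (hu : u ∈ S) (hv : v ∈ S)
    (huv : G.Adj u v)
    (hle : setWeight w (S ∩ G.halfTree v u) ≤ setWeight w (S ∩ G.halfTree u v)) :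
    G.optSum w (S ∩ G.halfTree s t) + G.optSum w (S ∩ G.halfTree t s) ≤
      G.optSum w (S ∩ G.halfTree u v) + G.optSum w (S ∩ G.halfTree v u) +
        setWeight w (S ∩ G.halfTree v u) := by
  have inside : ∀ s t, G.IsBalancedEdge w S s t → G.EdgeBeyond u v s t →
      G.optSum w (S ∩ G.halfTree s t) + G.optSum w (S ∩ G.halfTree t s) ≤
      G.optSum w (S ∩ G.halfTree u v) + G.optSum w (S ∩ G.halfTree v u) +
        setWeight w (S ∩ G.halfTree v u) := by
    intro s t h he
    obtain ⟨hs, ht, hst, -⟩ := id h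
    have hQ := hS.inter_halfTree hG hu hv huv
    have h1 := optSum_le hG w (hS.inter_halfTree hG hs ht hst) ⟨hu, he.left'⟩ ⟨hv, he.right'⟩ huv
    have h2 := hG.setWeight_split huv w (S ∩ G.halfTree s t)
    rw [he.inter_near hG, EdgeBeyond.inter_mid] at h1 h2
    have h3 : G.optSum w (S ∩ G.halfTree u v ∩ G.halfTree s t) +
        G.optSum w (S ∩ G.halfTree t s) + setWeight w (S ∩ G.halfTree u v ∩ G.halfTree s t) ≤
        G.optSum w (S ∩ G.halfTree u v) := by
      -- The weight of the piece between the edges is saved either way: as the minimum, or because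
      -- balance of `st` bounds all pieces cut off on its heavier `s`-side.
      rcases le_total (setWeight w (S ∩ G.halfTree u v ∩ G.halfTree s t))
        (setWeight w (S ∩ G.halfTree t s)) with hc | hc
      · have := optSum_sides_add_min_le hG hw hQ ⟨hs, he.left⟩ ⟨ht, he.right⟩ hst
        rwa [he.inter_far hG, min_eq_left hc] at this
      · have := optSum_sides_add_setWeight_le hG hw hQ ⟨hs, he.left⟩ ⟨ht, he.right⟩ hst
          fun x hx y hy hxy => by
            rw [he.inter_far hG]
            refine (setWeight_mono hw (inter_subset_inter_left _ inter_subset_left)).trans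
              (h.setWeight_piece_le hG hw hS ?_ hx.1 hy.1 hxy)
            have := setWeight_nonneg hw (S ∩ G.halfTree v u)
            linarith
        rwa [he.inter_far hG] at this
    linarith
  -- On the lighter side, `st` would leave a component strictly heavier than the heavier side of
  -- `uv`.
  have outside : ∀ s t, G.IsBalancedEdge w S s t → ¬ G.EdgeBeyond v u s t := by
    intro s t h he
    have h1 := h.max_le hG hS hu hv huv
    rw [max_eq_left hle] at h1
    have h2 := (le_max_left _ _).trans h1
    have h3 : setWeight w (S ∩ G.halfTree t s) < setWeight w (S ∩ G.halfTree v u) :=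
      setWeight_lt hw (inter_subset_inter_right _ (he.subset hG)) ⟨h.1, he.left⟩
        fun hx' => hG.right_notMem_halfTree he.adj'.symm hx'.2
    have h4 := hG.setWeight_split huv w S
    have h5 := hG.setWeight_split h.2.2.1 w S
    linarith
  have hpos := setWeight_nonneg hw (S ∩ G.halfTree v u)
  rcases hG.edgeBeyond_cases huv h.2.2.1 with he | he | he | he | he
  · rcases Sym2.eq_iff.1 he with ⟨rfl, rfl⟩ | ⟨rfl, rfl⟩ <;> linarith
  · exact inside s t h he
  · have := inside t s h.swap he
    linarith
  · exact absurd he (outside s t h)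
  · exact absurd he (outside t s h.swap)

theorem IsBalancedCutOutput.cases_inter (hG : G.IsTree) (hS : G.ConnectedOn S) {T : EPTree V}
    (hT : G.IsBalancedCutOutput w S T) : (∃ v, S = {v} ∧ T = .leaf v) ∨
      ∃ u v, G.IsBalancedEdge w S u v ∧ ∃ l r, G.IsBalancedCutOutput w (S ∩ G.halfTree u v) l ∧
        G.IsBalancedCutOutput w (S ∩ G.halfTree v u) r ∧ T = .node s(u, v) l r := by
  cases hT with
  | leaf v => exact Or.inl ⟨v, rfl, rfl⟩
  | @node _ u v l r huv hl hr =>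
    rw [hG.cutSide_eq hS huv.1 huv.2.1 huv.2.2.1] at hl
    rw [hG.cutSide_eq hS huv.2.1 huv.1 huv.2.2.1.symm] at hr
    exact Or.inr ⟨u, v, huv, l, r, hl, hr, rfl⟩

theorem IsBalancedCutOutput.isEPT {T : EPTree V} (hT : G.IsBalancedCutOutput w S T) :
    G.IsEPT S T := by
  induction hT with
  | leaf v => exact .leaf v
  | node huv _ _ ihl ihr => exact .node huv.1 huv.2.1 huv.2.2.1 ihl ihr

theorem exists_isBalancedEdge (w : V → ℝ) (hu : u ∈ S) (hv : v ∈ S) (huv : G.Adj u v) :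
    ∃ s t, G.IsBalancedEdge w S s t := by
  obtain ⟨⟨s, t⟩, ⟨hs, ht, hst⟩, hmin⟩ := Set.exists_min_image
    {p : V × V | p.1 ∈ S ∧ p.2 ∈ S ∧ G.Adj p.1 p.2} (fun p => G.cutWeight w S p.1 p.2)
    (toFinite _) ⟨(u, v), hu, hv, huv⟩
  exact ⟨s, t, hs, ht, hst, fun x hx y hy hxy => hmin (x, y) ⟨hx, hy, hxy⟩⟩

theorem IsTree.exists_isBalancedCutOutput (hG : G.IsTree) (w : V → ℝ) (hS : G.ConnectedOn S) :
    ∃ T, G.IsBalancedCutOutput w S T := by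
  induction S using WellFoundedLT.induction with
  | ind S ih =>
  rcases hS.eq_singleton_or_exists_adj with ⟨v, rfl⟩ | ⟨u, hu, v, hv, huv⟩
  · exact ⟨_, .leaf v⟩
  · obtain ⟨s, t, h⟩ := exists_isBalancedEdge w hu hv huv
    obtain ⟨hs, ht, hst, -⟩ := id h
    obtain ⟨l, hl⟩ := ih _ (hG.inter_halfTree_ssubset ht hst) (hS.inter_halfTree hG hs ht hst)
    obtain ⟨r, hr⟩ := ih _ (hG.inter_halfTree_ssubset hs hst.symm)
      (hS.inter_halfTree hG ht hs hst.symm)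
    rw [← hG.cutSide_eq hS hs ht hst] at hl
    rw [← hG.cutSide_eq hS ht hs hst.symm] at hr
    exact ⟨_, .node h hl hr⟩

end SimpleGraph

/-! ### The factor 3/2 -/

namespace SimpleGraph

variable {V : Type*} [Fintype V] {G : SimpleGraph V} {w : V → ℝ} {S A B : Set V} {u v x y s t : V}

/-- The two upper bounds on the cost `b` of a balanced cut output on `S` that are carried through
the induction. -/
structure ApproxBound (G : SimpleGraph V) (w : V → ℝ) (S : Set V) (b : ℝ) : Prop where
  le_optSum : b ≤ 3 / 2 * G.optSum w S
  le_of_edge : ∀ x ∈ S, ∀ y ∈ S, G.Adj x y →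
    setWeight w (S ∩ G.halfTree y x) ≤ setWeight w (S ∩ G.halfTree x y) →
    b ≤ setWeight w S + 3 / 2 * (G.optSum w (S ∩ G.halfTree x y) +
      G.optSum w (S ∩ G.halfTree y x) + setWeight w (S ∩ G.halfTree y x))

/-- The edges split S into C beyond `v`, R in the middle and Q beyond `y`, of weights γ, r, q. Put A
= R ∪ Q, α = r + q and Δ = OPT(R ∪ C) − OPT(R) − OPT(C). With c ≤ 3/2 OPT(C), the first bound on `a`
suffices once α ≤ W(S)/3 + Δ; the second, available if r ≤ q, once α + 3r/2 ≤ W(S)/2 + 3Δ/2. -/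
theorem IsBalancedEdge.add_le_of_root (hG : G.IsTree) (hw : ∀ v, 0 < w v) (hS : G.ConnectedOn S)
    (h : G.IsBalancedEdge w S u v) {a c : ℝ} (ha : G.ApproxBound w (S ∩ G.halfTree u v) a)
    (hc : G.ApproxBound w (S ∩ G.halfTree v u) c) (hx : x ∈ S) (hy : y ∈ S)
    (he : G.EdgeBeyond u v x y)
    (heq : G.optSum w S = setWeight w S + G.optSum w (S ∩ G.halfTree x y) +
      G.optSum w (S ∩ G.halfTree y x)) :
    setWeight w S + a + c ≤ 3 / 2 * G.optSum w S := by
  obtain ⟨hu, hv, huv, -⟩ := id h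
  have hS' := hS.inter_halfTree hG hx hy he.adj'
  have hu' : u ∈ S ∩ G.halfTree x y := ⟨hu, he.left'⟩
  have hv' : v ∈ S ∩ G.halfTree x y := ⟨hv, he.right'⟩
  have hA := he.optSum_side_le hG w hS hu hv hx hy
  have hWS := hG.setWeight_split huv w S
  have hWA := he.setWeight_side hG w S
  have ha1 := ha.le_optSum
  have hc1 := hc.le_optSum
  have ha2 := ha.le_of_edge y ⟨hy, he.right⟩ x ⟨hx, he.left⟩ he.adj'.symm
  have hc2 := hc.le_of_edge
  have hΔ := optSum_sides_add_min_le hG hw hS' hu' hv' huv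
  have hWS' := hG.setWeight_split huv w (S ∩ G.halfTree x y)
  have hrpos : 0 < setWeight w (S ∩ G.halfTree u v ∩ G.halfTree x y) :=
    setWeight_pos hw (x := u) ⟨⟨hu, left_mem_halfTree G u v⟩, he.left'⟩
  have hqpos := setWeight_nonneg hw (S ∩ G.halfTree y x)
  rw [he.inter_far hG] at ha2
  rw [he.inter_near hG, EdgeBeyond.inter_mid] at hΔ hWS'
  rcases le_or_gt (setWeight w (S ∩ G.halfTree u v)) (setWeight w (S ∩ G.halfTree v u)) with
    hαγ | hαγ
  -- Here Δ ≥ r and α ≤ W(S)/2; if q ≤ r, then q ≤ α/2 ≤ W(S)/4.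
  · rw [min_eq_left (by linarith)] at hΔ
    rcases le_total (setWeight w (S ∩ G.halfTree u v ∩ G.halfTree x y))
      (setWeight w (S ∩ G.halfTree y x)) with hrq | hrq
    · have := ha2 hrq
      linarith
    · linarith
  have hqγ := h.setWeight_piece_le hG hw hS hαγ.le hx hy he
  -- If γ ≤ W(S)/3, the full saving α ≥ 2W(S)/3 pays for the root, as 3α/2 ≥ W(S).
  rcases le_or_gt (3 * setWeight w (S ∩ G.halfTree v u)) (setWeight w S) with hγ | hγ
  · have := optSum_sides_add_setWeight_le hG hw hS hu hv huv
      fun x hx y hy he => h.setWeight_piece_le hG hw hS hαγ.le hx hy he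
    linarith
  -- Now α < 2W(S)/3 and γ > W(S)/3, so Δ ≥ γ suffices. This holds when R ∪ C has an optimal root at
  -- `uv` or inside R.
  rcases exists_optimal_root hG w hS' hu' hv' huv with h2 | ⟨x', hx', y', hy', he' | he', heq'⟩
  · rw [he.inter_near hG, EdgeBeyond.inter_mid] at h2
    linarith
  · have h1 := optSum_sides_le hG hw (hS'.inter_halfTree hG hx' hy' he'.adj') ⟨hu', he'.left'⟩
      ⟨hv', he'.right'⟩ huv
    have h2 := he'.optSum_side_le hG w hS' hu' hv' hx' hy'
    rw [he'.inter_near hG, he.inter_near hG, EdgeBeyond.inter_mid,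
      EdgeBeyond.inter_mid (x := x) (y := y)] at h1
    rw [EdgeBeyond.inter_mid] at h2
    linarith
  -- A root inside C splits it into R₂ next to R and Q₂, of weights r₂ and q₂, giving Δ ≥ r + min(r,
  -- r₂).
  · have h1 := optSum_sides_add_min_le hG hw (hS'.inter_halfTree hG hx' hy' he'.adj')
      ⟨hu', he'.right'⟩ ⟨hv', he'.left'⟩ huv
    have h2 := he'.optSum_side_le hG w hS' hv' hu' hx' hy'
    have h3 := he'.setWeight_side hG w (S ∩ G.halfTree x y)
    rw [he'.inter_near hG, EdgeBeyond.inter_mid (u := v), EdgeBeyond.inter_mid (u := u),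
      he.inter_near hG] at h1
    rw [he.inter_near hG] at h2 h3
    have h4 := hc2 y' ⟨hy'.1, he'.right⟩ x' ⟨hx'.1, he'.left⟩ he'.adj'.symm
    have h5 : S ∩ G.halfTree v u ∩ G.halfTree y' x' =
        S ∩ G.halfTree x y ∩ G.halfTree y' x' := by
      rw [← he.inter_near hG, he'.inter_far hG]
    rw [h5] at h4
    -- Above this threshold Δ ≥ 4r/3, and the bounds on `a` suffice.
    by_cases hΔ' : setWeight w (S ∩ G.halfTree u v ∩ G.halfTree x y) / 3 ≤
        min (setWeight w (S ∩ G.halfTree u v ∩ G.halfTree x y))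
          (setWeight w (S ∩ G.halfTree v u ∩ G.halfTree x' y'))
    · by_cases hrq : setWeight w (S ∩ G.halfTree u v ∩ G.halfTree x y) ≤
        setWeight w (S ∩ G.halfTree y x)
      · have := ha2 hrq
        linarith
      · linarith
    -- Otherwise r₂ < r/3. If r₂ ≤ q₂, the second bound is applied to `c`; if not, q ≤ γ < 2r₂ < r,
    -- and the first bounds suffice.
    · have hr2 : setWeight w (S ∩ G.halfTree v u ∩ G.halfTree x' y') <
          setWeight w (S ∩ G.halfTree u v ∩ G.halfTree x y) / 3 := by
        by_contra hcon
        exact hΔ' (le_min (by linarith) (not_lt.1 hcon))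
      rw [min_eq_right (by linarith)] at h1
      have hr2pos := setWeight_nonneg hw (S ∩ G.halfTree v u ∩ G.halfTree x' y')
      by_cases hrq : setWeight w (S ∩ G.halfTree v u ∩ G.halfTree x' y') ≤
        setWeight w (S ∩ G.halfTree x y ∩ G.halfTree y' x')
      · have := h4 hrq
        linarith
      · linarith

theorem IsBalancedEdge.add_le (hG : G.IsTree) (hw : ∀ v, 0 < w v) (hS : G.ConnectedOn S)
    (h : G.IsBalancedEdge w S u v) {a c : ℝ} (ha : G.ApproxBound w (S ∩ G.halfTree u v) a)
    (hc : G.ApproxBound w (S ∩ G.halfTree v u) c) :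
    setWeight w S + a + c ≤ 3 / 2 * G.optSum w S := by
  rcases exists_optimal_root hG w hS h.1 h.2.1 h.2.2.1 with h' | ⟨x, hx, y, hy, he | he, heq⟩
  · have h1 := ha.le_optSum
    have h2 := hc.le_optSum
    have h3 := setWeight_nonneg hw S
    linarith
  · exact h.add_le_of_root hG hw hS ha hc hx hy he heq
  · have := h.swap.add_le_of_root hG hw hS hc ha hx hy he heq
    linarith

theorem IsBalancedCutOutput.approxBound (hG : G.IsTree) (hw : ∀ v, 0 < w v)
    (hS : G.ConnectedOn S) {T : EPTree V} (hT : G.IsBalancedCutOutput w S T) :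
    G.ApproxBound w S (T.eptSum w) := by
  induction S using WellFoundedLT.induction generalizing T with
  | ind S ih =>
  rcases hT.cases_inter hG hS with ⟨v, rfl, rfl⟩ | ⟨u, v, h, l, r, hl, hr, rfl⟩
  · refine ⟨?_, fun x hx y hy hxy => absurd (hx.trans hy.symm) hxy.ne⟩
    simp [optSum_singleton hG, EPTree.eptSum, EPTree.weightedDepthSum]
  · obtain ⟨hu, hv, huv, -⟩ := id h
    have hl' := ih _ (hG.inter_halfTree_ssubset hv huv) (hS.inter_halfTree hG hu hv huv) hl
    have hr' := ih _ (hG.inter_halfTree_ssubset hu huv.symm)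
      (hS.inter_halfTree hG hv hu huv.symm) hr
    rw [IsEPT.eptSum_node hG hS hu hv huv hl.isEPT hr.isEPT]
    refine ⟨h.add_le hG hw hS hl' hr', fun x hx y hy hxy hle => ?_⟩
    have h1 := h.optSum_sides_le_of_edge hG hw hS hx hy hxy hle
    have h2 := hl'.le_optSum
    have h3 := hr'.le_optSum
    linarith

end SimpleGraph

/-! ### Sharpness: weighted spiders -/

namespace SimpleGraph

theorem _root_.EPTree.weightedDepthSum_nonneg {V : Type*} {w : V → ℝ} (hw : ∀ v, 0 < w v) (T : EPTree V) (d : ℕ) :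
    0 ≤ T.weightedDepthSum w d := by
  induction T generalizing d with
  | leaf v => exact mul_nonneg (hw v).le (Nat.cast_nonneg d)
  | node e l r ihl ihr => exact add_nonneg (ihl _) (ihr _)

section General

variable {V : Type*} [Fintype V] {G : SimpleGraph V} {w : V → ℝ} {S : Set V} {u v : V}

/-- A crude bound, enough for the light remainder of the spider once all tips are gone. -/
theorem optSum_le_ncard_mul (hG : G.IsTree) (hw : ∀ v, 0 < w v) (hS : G.ConnectedOn S) :
    G.optSum w S ≤ S.ncard * setWeight w S := by
  induction S using WellFoundedLT.induction with
  | ind S ih =>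
  rcases hS.eq_singleton_or_exists_adj with ⟨v, rfl⟩ | ⟨u, hu, v, hv, huv⟩
  · rw [optSum_singleton hG]
    exact mul_nonneg (Nat.cast_nonneg _) (setWeight_nonneg hw _)
  · have h1 := hS.inter_halfTree hG hu hv huv
    have h2 := hS.inter_halfTree hG hv hu huv.symm
    have h3 := ih _ (hG.inter_halfTree_ssubset hv huv) h1
    have h4 := ih _ (hG.inter_halfTree_ssubset hu huv.symm) h2
    have h5 := optSum_le hG w hS hu hv huv
    have h6 : (1 : ℝ) ≤ (S ∩ G.halfTree u v).ncard := by
      exact_mod_cast (ncard_pos (toFinite _)).2 h1.1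
    have h7 : (1 : ℝ) ≤ (S ∩ G.halfTree v u).ncard := by
      exact_mod_cast (ncard_pos (toFinite _)).2 h2.1
    have h8 := setWeight_nonneg hw (S ∩ G.halfTree u v)
    have h9 := setWeight_nonneg hw (S ∩ G.halfTree v u)
    rw [hG.ncard_split huv S, hG.setWeight_split huv w S]
    rw [hG.setWeight_split huv w S] at h5
    push_cast
    nlinarith [mul_le_mul_of_nonneg_right h6 h9, mul_le_mul_of_nonneg_right h7 h8]

theorem IsEPT.setWeight_le_eptSum (hG : G.IsTree) (hw : ∀ v, 0 < w v) (hS : G.ConnectedOn S)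
    {T : EPTree V} (hT : G.IsEPT S T) (hu : u ∈ S) (hv : v ∈ S) (huv : u ≠ v) :
    setWeight w S ≤ T.eptSum w := by
  rcases hT.cases_inter hG hS with ⟨a, rfl, _⟩ | ⟨x, hx, y, hy, hxy, l, r, hl, hr, rfl⟩
  · exact absurd (hu.trans hv.symm) huv
  · rw [IsEPT.eptSum_node hG hS hx hy hxy hl hr]
    have h1 : 0 ≤ l.eptSum w := l.weightedDepthSum_nonneg hw 0
    have h2 : 0 ≤ r.eptSum w := r.weightedDepthSum_nonneg hw 0
    linarith

end General

/-- In the spider, `a` is the parent of `b`: the centre `0` has the odd vertices as children, and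
each odd vertex has its successor as its only child. -/
def SpiderParent {n : ℕ} (a b : Fin (2 * n + 1)) : Prop :=
  (a.val = 0 ∧ b.val % 2 = 1) ∨ (a.val % 2 = 1 ∧ b.val = a.val + 1)

/-- The spider with `n` legs of length two. -/
def spider (n : ℕ) : SimpleGraph (Fin (2 * n + 1)) where
  Adj a b := SpiderParent a b ∨ SpiderParent b a
  symm := ⟨fun _ _ h => h.symm⟩
  loopless := ⟨fun a h => by simp only [SpiderParent] at h; omega⟩

/-- The vertices of the spider below `b`, including `b`. -/
def spiderBelow {n : ℕ} (b : Fin (2 * n + 1)) : Set (Fin (2 * n + 1)) :=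
  {z | z.val = b.val ∨ (b.val % 2 = 1 ∧ z.val = b.val + 1)}

/-- The leg with number `k` weighs `2 ^ (n - k)`, almost all of it on its tip. -/
noncomputable def spiderWeight (n : ℕ) (a : Fin (2 * n + 1)) : ℝ :=
  if a.val = 0 then 2 else if a.val % 2 = 1 then 1 else 2 ^ (n + 1 - a.val / 2) - 1

/-- The centre of the spider together with the legs numbered at least `k`. -/
def spiderTail (n k : ℕ) : Set (Fin (2 * n + 1)) := {a | a.val = 0 ∨ 2 * k < a.val}

/-- The spider without the tips of the legs numbered less than `k`. -/
def spiderTrim (n k : ℕ) : Set (Fin (2 * n + 1)) :=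
  {a | a.val = 0 ∨ a.val % 2 = 1 ∨ 2 * k < a.val}

variable {n k : ℕ} {a b : Fin (2 * n + 1)}

theorem spiderBelow_closed (h : SpiderParent a b) (c d : Fin (2 * n + 1)) (hcd : (spider n).Adj c d)
    (hc : c ∈ spiderBelow b) (hd : d ∉ spiderBelow b) : s(c, d) = s(b, a) := by
  have h' : SpiderParent c d ∨ SpiderParent d c := hcd
  simp only [spiderBelow, mem_ofPred_eq, SpiderParent] at h h' hc hd
  have h1 : c = b := Fin.ext (by omega)
  have h2 : d = a := Fin.ext (by omega)
  rw [h1, h2]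

theorem left_notMem_spiderBelow (h : SpiderParent a b) : a ∉ spiderBelow b := by
  simp only [spiderBelow, mem_ofPred_eq, SpiderParent] at h ⊢
  omega

theorem spider_isTree (n : ℕ) : (spider n).IsTree := by
  have hroot : ∀ a, (spider n).Reachable 0 a := by
    have hodd : ∀ a : Fin (2 * n + 1), a.val % 2 = 1 → (spider n).Reachable 0 a :=
      fun a ha => (show (spider n).Adj 0 a from Or.inl (Or.inl ⟨rfl, ha⟩)).reachable
    intro a
    by_cases h0 : a.val = 0
    · rw [show a = 0 from Fin.ext h0]
    by_cases h1 : a.val % 2 = 1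
    · exact hodd a h1
    · have hlt := a.isLt
      refine (hodd ⟨a.val - 1, by omega⟩ (by simp only; omega)).trans (Adj.reachable ?_)
      exact Or.inl (Or.inr ⟨by simp only; omega, by simp only; omega⟩)
  refine ⟨⟨fun a b => (hroot a).symm.trans (hroot b)⟩, ?_⟩
  rw [isAcyclic_iff_forall_adj_isBridge]
  have key : ∀ a b, SpiderParent a b → (spider n).IsBridge s(b, a) := fun a b h => by
    rw [isBridge_iff]
    exact fun hr => left_notMem_spiderBelow h
      (halfTree_subset_of_closed (A := spiderBelow b) (Or.inl rfl) (spiderBelow_closed h) hr)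
  intro a b hab
  rcases hab with h | h
  · rw [Sym2.eq_swap]
    exact key a b h
  · exact key b a h

theorem spider_halfTree_below (h : SpiderParent a b) :
    (spider n).halfTree b a = spiderBelow b :=
  (spider_isTree n).halfTree_eq_of_closed (show (spider n).Adj b a from Or.inr h) (Or.inl rfl)
    (left_notMem_spiderBelow h) (spiderBelow_closed h)

theorem spider_halfTree_above (h : SpiderParent a b) :
    (spider n).halfTree a b = (spiderBelow b)ᶜ := by
  ext z
  rw [(spider_isTree n).mem_halfTree_iff (show (spider n).Adj a b from Or.inl h),
    spider_halfTree_below h, mem_compl_iff]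

/-- The middle vertex of the leg with number `k`. -/
def spiderMid (hk : k < n) : Fin (2 * n + 1) := ⟨2 * k + 1, by omega⟩

/-- The tip of the leg with number `k`. -/
def spiderTip (hk : k < n) : Fin (2 * n + 1) := ⟨2 * k + 2, by omega⟩

theorem spiderParent_mid (hk : k < n) : SpiderParent 0 (spiderMid hk) :=
  Or.inl ⟨rfl, by simp only [spiderMid]; omega⟩

theorem spiderParent_tip (hk : k < n) : SpiderParent (spiderMid hk) (spiderTip hk) :=
  Or.inr ⟨by simp only [spiderMid]; omega, by simp only [spiderMid, spiderTip]⟩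

theorem spiderTail_inter_above (hk : k < n) :
    spiderTail n k ∩ (spider n).halfTree 0 (spiderMid hk) = spiderTail n (k + 1) := by
  rw [spider_halfTree_above (spiderParent_mid hk)]
  ext z
  simp only [spiderTail, spiderBelow, spiderMid, mem_inter_iff, mem_compl_iff, mem_ofPred_eq]
  omega

theorem spiderTail_inter_below_mid {j : ℕ} (hj : j < n) (hkj : k ≤ j) :
    spiderTail n k ∩ (spider n).halfTree (spiderMid hj) 0 = {spiderMid hj} ∪ {spiderTip hj} := by
  rw [spider_halfTree_below (spiderParent_mid hj)]
  ext z
  simp only [spiderTail, spiderBelow, spiderMid, spiderTip, mem_inter_iff, mem_ofPred_eq, mem_union,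
    mem_singleton_iff, Fin.ext_iff]
  omega

theorem spiderTail_inter_below_tip {j : ℕ} (hj : j < n) (hkj : k ≤ j) :
    spiderTail n k ∩ (spider n).halfTree (spiderTip hj) (spiderMid hj) = {spiderTip hj} := by
  rw [spider_halfTree_below (spiderParent_tip hj)]
  ext z
  simp only [spiderTail, spiderBelow, spiderTip, mem_inter_iff, mem_ofPred_eq,
    mem_singleton_iff, Fin.ext_iff]
  omega

theorem spiderTrim_inter_above (hk : k < n) :
    spiderTrim n k ∩ (spider n).halfTree (spiderMid hk) (spiderTip hk) = spiderTrim n (k + 1) := by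
  rw [spider_halfTree_above (spiderParent_tip hk)]
  ext z
  simp only [spiderTrim, spiderBelow, spiderTip, mem_inter_iff, mem_compl_iff, mem_ofPred_eq]
  omega

theorem spiderTrim_inter_below (hk : k < n) :
    spiderTrim n k ∩ (spider n).halfTree (spiderTip hk) (spiderMid hk) = {spiderTip hk} := by
  rw [spider_halfTree_below (spiderParent_tip hk)]
  ext z
  simp only [spiderTrim, spiderBelow, spiderTip, mem_inter_iff, mem_ofPred_eq,
    mem_singleton_iff, Fin.ext_iff]
  omega

theorem zero_mem_spiderTail : (0 : Fin (2 * n + 1)) ∈ spiderTail n k := Or.inl rfl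

theorem spiderMid_mem_spiderTail {j : ℕ} (hj : j < n) (hkj : k ≤ j) :
    spiderMid hj ∈ spiderTail n k := Or.inr (by simp only [spiderMid]; omega)

theorem spiderMid_mem_spiderTrim (hk : k < n) : spiderMid hk ∈ spiderTrim n k :=
  Or.inr (Or.inl (by simp only [spiderMid]; omega))

theorem spiderTip_mem_spiderTrim (hk : k < n) : spiderTip hk ∈ spiderTrim n k :=
  Or.inr (Or.inr (by simp only [spiderTip]; omega))

theorem spider_adj_mid (hk : k < n) : (spider n).Adj 0 (spiderMid hk) :=
  Or.inl (spiderParent_mid hk)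

theorem spider_adj_tip (hk : k < n) : (spider n).Adj (spiderMid hk) (spiderTip hk) :=
  Or.inl (spiderParent_tip hk)

theorem spiderTail_connectedOn (hk : k ≤ n) : (spider n).ConnectedOn (spiderTail n k) := by
  induction k with
  | zero =>
    convert (spider_isTree n).connectedOn_univ
    ext z
    simp only [spiderTail, mem_ofPred_eq, mem_univ, iff_true]
    omega
  | succ k ih =>
    rw [← spiderTail_inter_above hk]
    exact (ih (by omega)).inter_halfTree (spider_isTree n) zero_mem_spiderTail
      (spiderMid_mem_spiderTail hk le_rfl) (spider_adj_mid hk)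

theorem spiderTrim_zero (n : ℕ) : spiderTrim n 0 = univ := by
  ext z
  simp only [spiderTrim, mem_ofPred_eq, mem_univ, iff_true]
  omega

theorem spiderTrim_connectedOn (hk : k ≤ n) : (spider n).ConnectedOn (spiderTrim n k) := by
  induction k with
  | zero =>
    rw [spiderTrim_zero]
    exact (spider_isTree n).connectedOn_univ
  | succ k ih =>
    rw [← spiderTrim_inter_above hk]
    exact (ih (by omega)).inter_halfTree (spider_isTree n) (spiderMid_mem_spiderTrim hk)
      (spiderTip_mem_spiderTrim hk) (spider_adj_tip hk)

theorem spiderWeight_pos (n : ℕ) (a : Fin (2 * n + 1)) : 0 < spiderWeight n a := by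
  unfold spiderWeight
  split_ifs with h1 h2
  · norm_num
  · norm_num
  · have h : (1 : ℝ) < 2 ^ (n + 1 - a.val / 2) := one_lt_pow₀ (by norm_num) (by omega)
    linarith

theorem spiderWeight_mid (hk : k < n) : spiderWeight n (spiderMid hk) = 1 := by
  rw [spiderWeight, if_neg (by simp only [spiderMid]; omega),
    if_pos (by simp only [spiderMid]; omega)]

theorem spiderWeight_tip (hk : k < n) : spiderWeight n (spiderTip hk) = 2 ^ (n - k) - 1 := by
  rw [spiderWeight, if_neg (by simp only [spiderTip]; omega),
    if_neg (by simp only [spiderTip]; omega),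
    show n + 1 - (spiderTip hk).val / 2 = n - k by simp only [spiderTip]; omega]

theorem setWeight_spiderLeg (hk : k < n) :
    setWeight (spiderWeight n) ({spiderMid hk} ∪ {spiderTip hk}) = 2 ^ (n - k) := by
  rw [setWeight_union (by simp [spiderMid, spiderTip]), setWeight_singleton, setWeight_singleton,
    spiderWeight_mid, spiderWeight_tip]
  ring

/-- The centre's weight 2 starts the doubling, so the heaviest leg is exactly half of its tail. -/
theorem setWeight_spiderTail {j : ℕ} (hk : k + j = n) :
    setWeight (spiderWeight n) (spiderTail n k) = 2 ^ (j + 1) := by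
  induction j generalizing k with
  | zero =>
    have : spiderTail n k = {0} := by
      ext z
      simp only [spiderTail, mem_ofPred_eq, mem_singleton_iff, Fin.ext_iff, Fin.val_zero]
      omega
    rw [this, setWeight_singleton]
    simp [spiderWeight]
  | succ j ih =>
    have hk' : k < n := by omega
    rw [(spider_isTree n).setWeight_split (spider_adj_mid hk'), spiderTail_inter_above,
      spiderTail_inter_below_mid hk' le_rfl, ih (by omega), setWeight_spiderLeg,
      show n - k = j + 1 by omega]
    ring

/-- The only balanced edge of a tail of the spider joins the centre to its heaviest leg. -/
theorem isBalancedEdge_spiderTail (hk : k < n) (h : SpiderParent a b)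
    (hab : (spider n).IsBalancedEdge (spiderWeight n) (spiderTail n k) a b) :
    a = 0 ∧ b = spiderMid hk := by
  obtain ⟨j, rfl⟩ : ∃ j, n = k + j + 1 := ⟨n - k - 1, by omega⟩
  have hle := hab.max_le (spider_isTree _) (spiderTail_connectedOn hk.le) zero_mem_spiderTail
    (spiderMid_mem_spiderTail hk le_rfl) (spider_adj_mid hk)
  have hW := (spider_isTree _).setWeight_split hab.2.2.1 (spiderWeight (k + j + 1))
    (spiderTail (k + j + 1) k)
  rw [setWeight_spiderTail (j := j + 1) (by omega)] at hW
  -- Cutting off leg `k` is perfectly balanced. Any other edge has a strictly lighter lower side: a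
  -- lighter leg, or a tip without the weight 1 of its middle vertex.
  rw [spiderTail_inter_above, spiderTail_inter_below_mid hk le_rfl, setWeight_spiderLeg,
    setWeight_spiderTail (j := j) (by omega), show k + j + 1 - k = j + 1 by omega, max_self] at hle
  have hle' := (le_max_left _ _).trans hle
  have hb := hab.2.1
  have hlt := b.isLt
  rcases h with ⟨h1, h2⟩ | ⟨h1, h2⟩
  · obtain rfl : a = 0 := Fin.ext h1
    have hi : b.val / 2 < k + j + 1 := by omega
    have hki : k ≤ b.val / 2 := by
      simp only [spiderTail, mem_ofPred_eq] at hb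
      omega
    have hbi : b = spiderMid hi := Fin.ext (by simp only [spiderMid]; omega)
    refine ⟨rfl, ?_⟩
    by_contra hne
    have hki' : k < b.val / 2 := by
      refine lt_of_le_of_ne hki fun heq => hne ?_
      rw [hbi]
      exact Fin.ext (by simp only [spiderMid]; omega)
    rw [hbi, spiderTail_inter_below_mid hi hki, setWeight_spiderLeg] at hW
    rw [hbi] at hle'
    have h3 : (2 : ℝ) ^ (k + j + 1 - b.val / 2) < 2 ^ (j + 1) :=
      pow_lt_pow_right₀ (by norm_num) (by omega)
    have h4 : (2 : ℝ) ^ (j + 1 + 1) = 2 * 2 ^ (j + 1) := by ring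
    linarith
  · have hi : a.val / 2 < k + j + 1 := by omega
    have hki : k ≤ a.val / 2 := by
      simp only [spiderTail, mem_ofPred_eq] at hb
      omega
    have hai : a = spiderMid hi := Fin.ext (by simp only [spiderMid]; omega)
    have hbi : b = spiderTip hi := Fin.ext (by simp only [spiderTip]; omega)
    generalize hij : a.val / 2 = i at hi hki hai hbi
    subst hai hbi
    rw [spiderTail_inter_below_tip hi hki, setWeight_singleton, spiderWeight_tip] at hW
    have h3 : (2 : ℝ) ^ (k + j + 1 - i) ≤ 2 ^ (j + 1) :=
      pow_le_pow_right₀ (by norm_num) (by omega)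
    have h4 : (2 : ℝ) ^ (j + 1 + 1) = 2 * 2 ^ (j + 1) := by ring
    linarith

/-- Each round pays for the tail and then at least half as much for splitting the detached leg, and
the tail halves. -/
theorem le_eptSum_spiderTail {j : ℕ} (hk : k + j = n) {T : EPTree (Fin (2 * n + 1))}
    (hT : (spider n).IsBalancedCutOutput (spiderWeight n) (spiderTail n k) T) :
    3 * (2 ^ (j + 1) - 2) ≤ T.eptSum (spiderWeight n) := by
  induction j generalizing k T with
  | zero =>
    have h : 0 ≤ T.eptSum (spiderWeight n) := T.weightedDepthSum_nonneg (spiderWeight_pos n) 0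
    simpa using h
  | succ j ih =>
    have hk' : k < n := by omega
    have hG := spider_isTree n
    have hS := spiderTail_connectedOn hk'.le
    have hm := spiderMid_mem_spiderTail hk' le_rfl
    have key : ∀ l r, (spider n).IsBalancedCutOutput (spiderWeight n)
        (spiderTail n k ∩ (spider n).halfTree 0 (spiderMid hk')) l →
        (spider n).IsBalancedCutOutput (spiderWeight n)
        (spiderTail n k ∩ (spider n).halfTree (spiderMid hk') 0) r →
        3 * (2 ^ (j + 1 + 1) - 2) ≤ 2 ^ (j + 1 + 1) + l.eptSum (spiderWeight n) +
          r.eptSum (spiderWeight n) := by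
      intro l r hl hr
      have hS' := hS.inter_halfTree hG hm zero_mem_spiderTail (spider_adj_mid hk').symm
      rw [spiderTail_inter_above] at hl
      rw [spiderTail_inter_below_mid hk' le_rfl] at hr hS'
      have h1 := ih (by omega) hl
      have h2 := hr.isEPT.setWeight_le_eptSum hG (spiderWeight_pos n) hS' (Or.inl rfl) (Or.inr rfl)
        (spider_adj_tip hk').ne
      rw [setWeight_spiderLeg, show n - k = j + 1 by omega] at h2
      have h4 : (2 : ℝ) ^ (j + 1 + 1) = 2 * 2 ^ (j + 1) := by ring
      linarith
    rcases hT.cases_inter hG hS with ⟨v, hv, _⟩ | ⟨a, b, hab, l, r, hl, hr, rfl⟩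
    · have h1 : (0 : Fin (2 * n + 1)) ∈ spiderTail n k := zero_mem_spiderTail
      rw [hv] at h1 hm
      exact absurd (h1.trans hm.symm) (spider_adj_mid hk').ne
    · rw [IsEPT.eptSum_node hG hS hab.1 hab.2.1 hab.2.2.1 hl.isEPT hr.isEPT,
        setWeight_spiderTail hk]
      rcases hab.2.2.1 with h | h
      · obtain ⟨rfl, rfl⟩ := isBalancedEdge_spiderTail hk' h hab
        exact key l r hl hr
      · obtain ⟨rfl, rfl⟩ := isBalancedEdge_spiderTail hk' h hab.swap
        have := key r l hr hl
        linarith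

theorem setWeight_spiderTrim_le {j : ℕ} (hk : k + j = n) :
    setWeight (spiderWeight n) (spiderTrim n k) ≤ 2 ^ (j + 1) + 2 * (2 * n + 1) := by
  induction j generalizing k with
  | zero =>
    have h : setWeight (spiderWeight n) (spiderTrim n k) ≤ ∑ _ : Fin (2 * n + 1), (2 : ℝ) := by
      refine Finset.sum_le_sum fun a _ => indicator_apply_le' (fun ha => ?_) (fun _ => by norm_num)
      have hlt := a.isLt
      simp only [spiderTrim, mem_ofPred_eq] at ha
      unfold spiderWeight
      split_ifs with h1 h2
      · norm_num
      · norm_num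
      · omega
    simp only [Finset.sum_const, Finset.card_univ, Fintype.card_fin, nsmul_eq_mul] at h
    push_cast at h
    rw [zero_add, pow_one]
    linarith
  | succ j ih =>
    have hk' : k < n := by omega
    have h := ih (k := k + 1) (by omega)
    rw [(spider_isTree n).setWeight_split (spider_adj_tip hk'), spiderTrim_inter_above,
      spiderTrim_inter_below, setWeight_singleton, spiderWeight_tip, show n - k = j + 1 by omega]
    have h4 : (2 : ℝ) ^ (j + 1 + 1) = 2 * 2 ^ (j + 1) := by ring
    linarith

/-- Tips are cut heaviest first, so the main terms form a geometric sum; all other vertices weigh at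
most 2 and contribute only O(n) per cut and O(n²) at the end. -/
theorem optSum_spiderTrim_le {j : ℕ} (hk : k + j = n) :
    (spider n).optSum (spiderWeight n) (spiderTrim n k) ≤
      2 * 2 ^ (j + 1) + (2 * j + 2 * (2 * n + 1) + 2) * (2 * n + 1) := by
  induction j generalizing k with
  | zero =>
    have h1 := optSum_le_ncard_mul (spider_isTree n) (spiderWeight_pos n)
      (spiderTrim_connectedOn (n := n) (k := k) (by omega))
    have h2 := setWeight_spiderTrim_le hk
    have h3 : ((spiderTrim n k).ncard : ℝ) ≤ 2 * n + 1 := by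
      have := ncard_le_ncard (subset_univ (spiderTrim n k))
      rw [ncard_univ, Nat.card_fin] at this
      exact_mod_cast this
    have h4 := mul_le_mul h3 h2 (setWeight_nonneg (spiderWeight_pos n) _) (by positivity)
    rw [zero_add, pow_one] at h4 ⊢
    push_cast
    nlinarith
  | succ j ih =>
    have hk' : k < n := by omega
    have h1 := ih (k := k + 1) (by omega)
    have h2 := optSum_le (spider_isTree n) (spiderWeight n) (spiderTrim_connectedOn hk'.le)
      (spiderMid_mem_spiderTrim hk') (spiderTip_mem_spiderTrim hk') (spider_adj_tip hk')
    rw [spiderTrim_inter_above, spiderTrim_inter_below, optSum_singleton (spider_isTree n)] at h2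
    have h3 := setWeight_spiderTrim_le hk
    have h4 : (2 : ℝ) ^ (j + 1 + 1) = 2 * 2 ^ (j + 1) := by ring
    push_cast
    linarith

theorem exists_sq_lt_two_pow {c : ℝ} (hc : c < 3 / 2) (N : ℕ) :
    ∃ n : ℕ, N ≤ n ∧ 1 ≤ n ∧ 100 * (n : ℝ) ^ 2 < (3 - 2 * c) * 2 ^ (n + 1) := by
  have h := tendsto_pow_const_div_const_pow_of_one_lt 2 (one_lt_two : (1 : ℝ) < 2)
  have h' := (h.eventually (gt_mem_nhds (show (0 : ℝ) < (3 - 2 * c) / 50 by linarith))).and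
    (Filter.eventually_ge_atTop (N + 1))
  obtain ⟨n, hn, hN⟩ := h'.exists
  refine ⟨n, by omega, by omega, ?_⟩
  rw [div_lt_iff₀ (by positivity)] at hn
  rw [pow_succ (2 : ℝ) n]
  linarith

theorem spider_ratio {c : ℝ} (hc : c < 3 / 2) (hn : 1 ≤ n)
    (h : 100 * (n : ℝ) ^ 2 < (3 - 2 * c) * 2 ^ (n + 1)) {T : EPTree (Fin (2 * n + 1))}
    (hT : (spider n).IsBalancedCutOutput (spiderWeight n) univ T) :
    c * (spider n).eptSum (spiderWeight n) < T.eptSum (spiderWeight n) := by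
  have hopt : (spider n).eptSum (spiderWeight n) = (spider n).optSum (spiderWeight n) univ := rfl
  have h1 := optSum_spiderTrim_le (n := n) (zero_add n)
  rw [spiderTrim_zero, ← hopt] at h1
  have huniv : spiderTail n 0 = univ := by
    ext z
    simp only [spiderTail, mem_ofPred_eq, mem_univ, iff_true]
    omega
  rw [← huniv] at hT
  have h2 := le_eptSum_spiderTail (zero_add n) hT
  have hn' : (1 : ℝ) ≤ n := by exact_mod_cast hn
  have hpow : (2 : ℝ) ^ 2 ≤ 2 ^ (n + 1) := pow_le_pow_right₀ (by norm_num) (by omega)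
  -- The upper bound on the optimum can be multiplied by `c` only if `c` is nonnegative; otherwise
  -- nonnegativity of the optimum is enough.
  rcases le_or_gt c 0 with hc0 | hc0
  · have h0 : 0 ≤ (spider n).eptSum (spiderWeight n) := by
      refine Real.sInf_nonneg ?_
      rintro _ ⟨T, _, rfl⟩
      exact T.weightedDepthSum_nonneg (spiderWeight_pos n) 0
    nlinarith
  · have h3 := mul_le_mul_of_nonneg_left h1 hc0.le
    -- The error is at most 3/2 · 30n² = 45n²; with the 6 lost in 3(2^(n+1) − 2), it stays below
    -- 100n².
    have h4 : (2 * (n : ℝ) + 2 * (2 * n + 1) + 2) * (2 * n + 1) ≤ 30 * (n : ℝ) ^ 2 := by nlinarith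
    have h5 := mul_le_mul hc.le h4 (by positivity) (by norm_num)
    nlinarith

end SimpleGraph

theorem mainTheorem2 :
    (∀ (V : Type*) [Fintype V] (G : SimpleGraph V) (w : V → ℝ),
      G.IsTree → (∀ v, 0 < w v) →
        IsLeast (G.eptSumValues w) (G.eptSum w) ∧
        (∃ T : EPTree V, G.IsBalancedCutOutput w univ T) ∧
        ∀ T : EPTree V, G.IsBalancedCutOutput w univ T →
          G.IsEPT univ T ∧ T.eptSum w ≤ 3 / 2 * G.eptSum w) ∧
    (∀ c : ℝ, c < 3 / 2 → ∀ N : ℕ, ∃ n : ℕ, N ≤ n ∧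
      ∃ (G : SimpleGraph (Fin n)) (w : Fin n → ℝ),
        G.IsTree ∧ (∀ v, 0 < w v) ∧
        ∀ T : EPTree (Fin n), G.IsBalancedCutOutput w univ T →
          c * G.eptSum w < T.eptSum w) := by
  constructor
  · intro V _ G w hG hw
    have hS := hG.connectedOn_univ
    exact ⟨hG.isLeast_optSum w hS, hG.exists_isBalancedCutOutput w hS,
      fun T hT => ⟨hT.isEPT, (hT.approxBound hG hw hS).le_optSum⟩⟩
  · intro c hc N
    obtain ⟨n, hN, hn, h⟩ := SimpleGraph.exists_sq_lt_two_pow hc N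
    exact ⟨2 * n + 1, by omega, SimpleGraph.spider n, SimpleGraph.spiderWeight n,
      SimpleGraph.spider_isTree n, SimpleGraph.spiderWeight_pos n,
      fun T hT => SimpleGraph.spider_ratio hc hn h hT⟩
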